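/- Definitions. Let $Y$ be a metric space, $X\subset Y$ a subset with the induced metric, $E$ a real Banach space and $f\colon X\to E$ a Lipschitz map with Lipschitz constant $\mathrm{Lip}(f)=\inf\{L\ge 0: f \text{ is } L\text{-Lipschitz}\}$. Let $e(X,Y,E,f)$ be the infimum of those $K\ge 0$ for which $f$ has a $K\,\mathrm{Lip}(f)$-Lipschitz extension $\bar f\colon Y\to E$, let $\nu(X,Y)=\sup\{e(X,Y,E,f)\}$ over all real Banach spaces $E$ and all Lipschitz maps $f\colon X\to E$, and let the absolute extendability constant of a metric space $X$ be $\mathrm{ae}(X)=\sup_Y \nu(X,Y)$, the supremum over all metric spaces $Y$ containing $X$ isometrically. For a metric space $X$ with base point $p\in X$, let $\mathrm{Lip}_0(X)$ be the space of Lipschitz functions $f\colon X\to\mathbb R$ with $f(p)=0$, normed by $\sup_{x\ne x'}|f(x)-f(x')|/d(x,x')$, and let the Lipschitz-free space $\mathcal F(X)$ be the closure of $\mathrm{span}\{\delta(x):x\in X\}$ in the dual space $\mathrm{Lip}_0(X)^*$, where $\delta(x)(f)=f(x)$. If $\iota\colon X\to Y$ is an isometric embedding and $Y$ has the base point $\iota(p)$,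 there is a unique linear isometric embedding $\hat\iota\colon\mathcal F(X)\to\mathcal F(Y)$ with $\hat\iota(\delta(x))=\delta(\iota(x))$ for all $x\in X$; through it $\mathcal F(X)$, equivalently $\mathcal F(\iota(X))$, is regarded as a subspace of $\mathcal F(Y)$. For a subspace $E$ of a Banach space $F$, the relative projection constant $\lambda(E,F)$ is the infimum of $\|P\|$ over all bounded linear projections $P$ of $F$ onto $E$. All these constants take values in $[0,\infty]$, with $\inf\varnothing=\infty$. Theorem. Let $X$ be a non-empty finite metric space and let $p\in X$ be any base point. Then $$\mathrm{ae}(X)=\sup_{Y}\lambda\bigl(\mathcal F(X),\mathcal F(Y)\bigr),$$ where the supremum is taken over all finite metric spaces $Y$ containing $X$ isometrically. Moreover, $$\mathrm{ae}(X)=\lambda\bigl(\mathcal F(\iota(X)),\mathcal F(c_0)\bigr)$$ for every isometric embedding $\iota\colon X\to c_0$, where $c_0$ is the space of real null sequences with the supremum norm and $\mathcal F(\iota(X))$, $\mathcal F(c_0)$ are formed with the base point $\iota(p)$. -/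

import Mathlib

open scoped NNReal ENNReal ZeroAtInfty

universe u v w

noncomputable section

namespace LipExt

/-! ### Nonlinear Lipschitz extension constants

All constants take values in `[0, ∞]`, so that suprema are genuine and an infimum over the empty
set is `∞`. -/

/-- The Lipschitz constant `Lip(f) = inf {L ≥ 0 : f is L-Lipschitz}` (used for Lipschitz `f`). -/
def lipConst {X : Type*} {E : Type*} [MetricSpace X] [NormedAddCommGroup E] (f : X → E) : ℝ≥0 :=
  sInf {L : ℝ≥0 | LipschitzWith L f}

/-- `e(S, Y, E, f)`: the infimum of those `K ≥ 0` such that `f : S → E` extends to a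
`K * Lip(f)`-Lipschitz map `Y → E`. -/
def extModulus {Y : Type*} {E : Type*} [MetricSpace Y] [NormedAddCommGroup E]
    (S : Set Y) (f : S → E) : ℝ≥0∞ :=
  ⨅ (K : ℝ≥0) (_ : ∃ g : Y → E, LipschitzWith (K * lipConst f) g ∧ ∀ x : S, g x = f x), (K : ℝ≥0∞)

/-- `ν(S, Y)`: the supremum of `e(S, Y, E, f)` over all real Banach spaces `E` and all Lipschitz
maps `f : S → E`. -/
def traceConst {Y : Type v} [MetricSpace Y] (S : Set Y) : ℝ≥0∞ :=
  ⨆ (E : Type w) (_ : NormedAddCommGroup E) (_ : NormedSpace ℝ E) (_ : CompleteSpace E)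
    (f : S → E) (_ : ∃ L : ℝ≥0, LipschitzWith L f), extModulus S f

/-- The absolute extendability constant `ae(X)`: the supremum of `ν(X, Y)` over all metric spaces
`Y` containing an isometric copy of `X`. -/
def absExt (X : Type u) [MetricSpace X] : ℝ≥0∞ :=
  ⨆ (Y : Type v) (_ : MetricSpace Y) (ι : X → Y) (_ : Isometry ι),
    traceConst.{v, w} (Set.range ι)

/-! ### The Banach space `Lip₀(X)` -/

/-- The vector space of real Lipschitz functions on `X` that vanish at the base point `p`. -/
def lipSubmodule (X : Type*) [MetricSpace X] (p : X) : Submodule ℝ (X → ℝ) where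
  carrier := {f | f p = 0 ∧ ∃ K : ℝ≥0, LipschitzWith K f}
  add_mem' := by
    rintro f g ⟨hf, K, hK⟩ ⟨hg, L, hL⟩
    exact ⟨by simp [hf, hg], K + L, hK.add hL⟩
  zero_mem' := ⟨rfl, 0, LipschitzWith.const 0⟩
  smul_mem' := by
    rintro c f ⟨hf, K, hK⟩
    refine ⟨by simp [hf], ‖c‖₊ * K, LipschitzWith.of_dist_le_mul fun x y => ?_⟩
    have h := hK.dist_le_mul x y
    simp only [Pi.smul_apply, dist_smul₀, NNReal.coe_mul, coe_nnnorm]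
    rw [mul_assoc]
    exact mul_le_mul_of_nonneg_left h (norm_nonneg c)

/-- `Lip₀(X)` for the pointed metric space `(X, p)`. -/
def Lip0 (X : Type*) [MetricSpace X] (p : X) : Type _ := lipSubmodule X p

namespace Lip0

variable {X : Type*} [MetricSpace X] {p : X}

instance : AddCommGroup (Lip0 X p) := inferInstanceAs (AddCommGroup (lipSubmodule X p))

instance : Module ℝ (Lip0 X p) := inferInstanceAs (Module ℝ (lipSubmodule X p))

instance : CoeFun (Lip0 X p) (fun _ => X → ℝ) := ⟨fun f => f.1⟩

theorem add_apply (f g : Lip0 X p) (x : X) : (f + g) x = f x + g x := rfl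

theorem smul_apply (c : ℝ) (f : Lip0 X p) (x : X) : (c • f) x = c * f x := rfl

theorem apply_base (f : Lip0 X p) : f p = 0 := f.2.1

/-- `|f|_Lip = sup_{x ≠ y} |f x - f y| / d(x, y)`. The diagonal terms are `0 / 0 = 0` and do not
change the supremum of nonnegative numbers (which is `0` on a one-point space). -/
instance : Norm (Lip0 X p) := ⟨fun f => ⨆ q : X × X, |f q.1 - f q.2| / dist q.1 q.2⟩

theorem norm_def (f : Lip0 X p) : ‖f‖ = ⨆ q : X × X, |f q.1 - f q.2| / dist q.1 q.2 := rfl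

theorem bddAbove (f : Lip0 X p) :
    BddAbove (Set.range fun q : X × X => |f q.1 - f q.2| / dist q.1 q.2) := by
  obtain ⟨K, hK⟩ := f.2.2
  refine ⟨K, ?_⟩
  rintro _ ⟨q, rfl⟩
  have h := hK.dist_le_mul q.1 q.2
  rw [Real.dist_eq] at h
  exact div_le_of_le_mul₀ dist_nonneg K.2 h

theorem abs_sub_le (f : Lip0 X p) (x y : X) : |f x - f y| ≤ ‖f‖ * dist x y := by
  rcases eq_or_ne x y with rfl | hxy
  · simp
  · rw [← div_le_iff₀ (dist_pos.2 hxy)]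
    exact le_ciSup (bddAbove f) (x, y)

theorem norm_le (f : Lip0 X p) {C : ℝ} (hC : 0 ≤ C) (h : ∀ x y, |f x - f y| ≤ C * dist x y) :
    ‖f‖ ≤ C :=
  Real.iSup_le (fun q => div_le_of_le_mul₀ dist_nonneg hC (h q.1 q.2)) hC

theorem norm_nonneg' (f : Lip0 X p) : 0 ≤ ‖f‖ :=
  Real.iSup_nonneg fun _ => div_nonneg (abs_nonneg _) dist_nonneg

theorem core : NormedSpace.Core ℝ (Lip0 X p) where
  norm_nonneg := norm_nonneg'
  norm_smul c f := by
    simp only [norm_def, smul_apply, ← mul_sub, abs_mul, mul_div_assoc, Real.norm_eq_abs]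
    rw [Real.mul_iSup_of_nonneg (abs_nonneg c)]
  norm_triangle f g := by
    refine norm_le _ (add_nonneg (norm_nonneg' f) (norm_nonneg' g)) fun x y => ?_
    have h1 := abs_sub_le f x y
    have h2 := abs_sub_le g x y
    have h3 := abs_add_le (f x - f y) (g x - g y)
    rw [add_apply, add_apply, add_mul, add_sub_add_comm]
    linarith
  norm_eq_zero_iff f := by
    constructor
    · intro h
      refine Subtype.ext (funext fun x => ?_)
      have h1 := abs_sub_le f x p
      rw [h, zero_mul, apply_base, sub_zero] at h1
      exact abs_nonpos_iff.1 h1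
    · rintro rfl
      refine le_antisymm (norm_le _ le_rfl fun x y => ?_) (norm_nonneg' _)
      have h0 : ∀ z, (0 : Lip0 X p) z = 0 := fun _ => rfl
      simp [h0]

instance : NormedAddCommGroup (Lip0 X p) := NormedAddCommGroup.ofCore core

instance : NormedSpace ℝ (Lip0 X p) := NormedSpace.ofCore core

/-- Restriction `f ↦ f ∘ ι` along a base-point preserving isometric embedding. -/
def restrict {Y : Type*} [MetricSpace Y] (p : X) (ι : X → Y) (hι : Isometry ι) :
    Lip0 Y (ι p) →L[ℝ] Lip0 X p :=
  LinearMap.mkContinuous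
    { toFun := fun f => ⟨fun x => f (ι x), f.2.1, by
        obtain ⟨K, hK⟩ := f.2.2
        exact ⟨K * 1, hK.comp hι.lipschitz⟩⟩
      map_add' := fun _ _ => rfl
      map_smul' := fun _ _ => rfl } 1 (fun f => by
        rw [one_mul]
        refine norm_le _ (norm_nonneg f) fun x y => ?_
        rw [← hι.dist_eq]
        exact abs_sub_le f (ι x) (ι y))

end Lip0

/-! ### Lipschitz-free spaces -/

/-- The evaluation functional `δ(x) : Lip₀(X) → ℝ`. -/
def delta {X : Type*} [MetricSpace X] (p : X) (x : X) : StrongDual ℝ (Lip0 X p) :=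
  LinearMap.mkContinuous
    { toFun := fun f => f x
      map_add' := fun _ _ => rfl
      map_smul' := fun _ _ => rfl } (dist x p) (fun f => by
        have h := Lip0.abs_sub_le f x p
        rw [Lip0.apply_base, sub_zero] at h
        rw [mul_comm] at h
        exact h)

/-- The Lipschitz-free space `𝓕(X)` of the pointed metric space `(X, p)`: the closure of
`span {δ(x) : x ∈ X}` in `Lip₀(X)*`. -/
def freeSpace (X : Type*) [MetricSpace X] (p : X) : Submodule ℝ (StrongDual ℝ (Lip0 X p)) :=
  (Submodule.span ℝ (Set.range (delta p))).topologicalClosure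

/-- The adjoint `Lip₀(X)* → Lip₀(Y)*` of the restriction map along `ι`. -/
def dualMap {X Y : Type*} [MetricSpace X] [MetricSpace Y] (p : X) (ι : X → Y) (hι : Isometry ι) :
    StrongDual ℝ (Lip0 X p) →L[ℝ] StrongDual ℝ (Lip0 Y (ι p)) :=
  (Lip0.restrict p ι hι).precomp ℝ

theorem dualMap_delta {X Y : Type*} [MetricSpace X] [MetricSpace Y] (p : X) (ι : X → Y)
    (hι : Isometry ι) (x : X) : dualMap p ι hι (delta p x) = delta (ι p) (ι x) := rfl

theorem dualMap_mem {X Y : Type*} [MetricSpace X] [MetricSpace Y] (p : X) (ι : X → Y)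
    (hι : Isometry ι) (φ : freeSpace X p) :
    dualMap p ι hι (φ : StrongDual ℝ (Lip0 X p)) ∈ freeSpace Y (ι p) := by
  have h : freeSpace X p ≤ (freeSpace Y (ι p)).comap (dualMap p ι hι).toLinearMap := by
    refine Submodule.topologicalClosure_minimal _ ?_ ?_
    · rw [Submodule.span_le]
      rintro _ ⟨x, rfl⟩
      exact Submodule.le_topologicalClosure _ (Submodule.subset_span ⟨ι x, rfl⟩)
    · exact (Submodule.isClosed_topologicalClosure _).preimage (dualMap p ι hι).continuous
  exact h φ.2

/-- The canonical linear embedding `ι̂ : 𝓕(X) → 𝓕(Y)` induced by an isometric embedding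
`ι : (X, p) → (Y, ι p)`; it is determined by `ι̂ (δ(x)) = δ(ι x)`. -/
def freeMap {X Y : Type*} [MetricSpace X] [MetricSpace Y] (p : X) (ι : X → Y) (hι : Isometry ι) :
    freeSpace X p →L[ℝ] freeSpace Y (ι p) :=
  ((dualMap p ι hι).comp (freeSpace X p).subtypeL).codRestrict _ (dualMap_mem p ι hι)

/-! ### Relative projection constants -/

/-- `λ(E, F)`: the infimum of the norms of all bounded linear projections of `F` onto its
subspace `E`. -/
def projConst {F : Type*} [NormedAddCommGroup F] [NormedSpace ℝ F] (E : Submodule ℝ F) : ℝ≥0∞ :=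
  ⨅ (P : F →L[ℝ] E) (_ : ∀ x : E, P x = x), ‖P‖ₑ

/-- `λ(𝓕(X), 𝓕(Y))`, where `X` is viewed inside `Y` by the isometric embedding `ι`, the base
points are `p ∈ X` and `ι p ∈ Y`, and `𝓕(X)` is identified with the subspace `ι̂(𝓕(X))` of
`𝓕(Y)`. -/
def freeProjConst {X Y : Type*} [MetricSpace X] [MetricSpace Y] (p : X) (ι : X → Y)
    (hι : Isometry ι) : ℝ≥0∞ :=
  projConst (F := freeSpace Y (ι p)) (LinearMap.range (freeMap p ι hι).toLinearMap)

end LipExt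

end

noncomputable section

namespace LipExt

/-! ### Lipschitz constants and the spaces `Lip₀` -/

/-! Both sides are compared with `deltaExtConst p ι`, the best Lipschitz constant of an extension of
`δ` from `X` to `Y`. For finite `X`, `𝓕(X)` is all of the finite-dimensional space `Lip₀(X)*`. Every
Lipschitz `f : X → E` is, up to a translation, `δ` followed by a linear map of norm at most
`Lip(f)`, so `δ` is the hardest map to extend (`traceConst_eq`). A `K`-Lipschitz extension of `δ` to
`Y` linearizes to a left inverse of `𝓕(X) → 𝓕(Y)` of norm at most `K`, and a left inverse restricts
to such an extension (`freeProjConst_eq`).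

Two facts about suprema over `Y` remain. Bounded sets in `Lip₀(X)*` are relatively compact, so
extensions to finite subspaces have a limit (`deltaExtConst_le_of_finite`). And every `Y` maps to
`c₀` without expansion over `X`, so `c₀` is the worst case (`exists_lipschitz_extension_c0`). -/

theorem lipschitzWith_lipConst {X E : Type*} [MetricSpace X] [NormedAddCommGroup E] {f : X → E}
    (hf : ∃ L : ℝ≥0, LipschitzWith L f) : LipschitzWith (lipConst f) f := by
  refine LipschitzWith.of_dist_le_mul fun x y => ?_
  rcases eq_or_ne x y with rfl | hxy
  · simp
  · have hd : 0 < dist x y := dist_pos.2 hxy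
    rw [← div_le_iff₀ hd]
    refine Real.toNNReal_le_iff_le_coe.1 (le_csInf hf fun L hL => ?_)
    exact Real.toNNReal_le_iff_le_coe.2 ((div_le_iff₀ hd).2 (hL.dist_le_mul x y))

theorem lipConst_le {X E : Type*} [MetricSpace X] [NormedAddCommGroup E] {f : X → E} {L : ℝ≥0}
    (hf : LipschitzWith L f) : lipConst f ≤ L :=
  csInf_le (OrderBot.bddBelow _) hf

/-- A function on the image of an isometric embedding extends with the same Lipschitz constant. -/
theorem exists_lipschitz_extension {X Y : Type*} [MetricSpace X] [MetricSpace Y] {ι : X → Y}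
    (hι : Isometry ι) {K : ℝ≥0} {f : X → ℝ} (hf : LipschitzWith K f) :
    ∃ g : Y → ℝ, LipschitzWith K g ∧ ∀ x, g (ι x) = f x := by
  rcases isEmpty_or_nonempty X with hX | hX
  · exact ⟨fun _ => 0, (LipschitzWith.const 0).weaken zero_le, fun x => (hX.false x).elim⟩
  have hinv : ∀ x, Function.invFun ι (ι x) = x := Function.leftInverse_invFun hι.injective
  have h : LipschitzOnWith K (fun y => f (Function.invFun ι y)) (Set.range ι) := by
    refine LipschitzOnWith.of_dist_le_mul ?_
    rintro _ ⟨x, rfl⟩ _ ⟨y, rfl⟩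
    simp only [hinv, hι.dist_eq]
    exact hf.dist_le_mul x y
  obtain ⟨g, hg, hfg⟩ := h.extend_real
  refine ⟨g, hg, fun x => ?_⟩
  rw [← hfg ⟨x, rfl⟩]
  simp only [hinv]

namespace Lip0

variable {X : Type*} [MetricSpace X] {p : X}

theorem lipschitzWith (f : Lip0 X p) : LipschitzWith ‖f‖₊ (f : X → ℝ) :=
  LipschitzWith.of_dist_le_mul fun x y => abs_sub_le f x y

theorem ext {f g : Lip0 X p} (h : ∀ x, f x = g x) : f = g := Subtype.ext (funext h)

theorem sum_apply {ι : Type*} (s : Finset ι) (f : ι → Lip0 X p) (x : X) :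
    (∑ i ∈ s, f i) x = ∑ i ∈ s, f i x :=
  map_sum (delta p x) f s

theorem abs_apply_sub_le {Y : Type*} [MetricSpace Y] {K : ℝ≥0} (r : Y → StrongDual ℝ (Lip0 X p))
    (hr : LipschitzWith K r) (h : Lip0 X p) (x y : Y) :
    |r x h - r y h| ≤ K * ‖h‖ * dist x y := by
  have h1 := (r x - r y).le_opNorm h
  have h2 := hr.dist_le_mul x y
  rw [dist_eq_norm] at h2
  calc |r x h - r y h| ≤ ‖r x - r y‖ * ‖h‖ := h1
    _ ≤ K * dist x y * ‖h‖ := by gcongr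
    _ = _ := by ring

/-- The linear map `h ↦ (y ↦ r y h)` from `Lip₀(X)` to `Lip₀(Y)` given by a Lipschitz map
`r : Y → Lip₀(X)*`. -/
def pull {Y : Type*} [MetricSpace Y] {q : Y} {K : ℝ≥0} (r : Y → StrongDual ℝ (Lip0 X p))
    (hr : LipschitzWith K r) (hq : r q = 0) : Lip0 X p →L[ℝ] Lip0 Y q :=
  LinearMap.mkContinuous
    { toFun := fun h => ⟨fun y => r y h, by simp [hq], K * ‖h‖₊,
        LipschitzWith.of_dist_le_mul fun x y => abs_apply_sub_le r hr h x y⟩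
      map_add' := fun f g => ext fun y => (r y).map_add f g
      map_smul' := fun c f => ext fun y => (r y).map_smul c f } K
    (fun h => norm_le _ (by positivity) (abs_apply_sub_le r hr h))

theorem norm_pull_le {Y : Type*} [MetricSpace Y] {q : Y} {K : ℝ≥0}
    (r : Y → StrongDual ℝ (Lip0 X p)) (hr : LipschitzWith K r) (hq : r q = 0) :
    ‖pull r hr hq‖ ≤ K :=
  LinearMap.mkContinuous_norm_le _ K.2 fun h =>
    norm_le _ (mul_nonneg K.2 (norm_nonneg h)) (abs_apply_sub_le r hr h)

instance [Finite X] : FiniteDimensional ℝ (Lip0 X p) :=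
  inferInstanceAs (FiniteDimensional ℝ (lipSubmodule X p))

/-- On a finite metric space every function vanishing at the base point is in `Lip₀`. -/
def ofFun [Finite X] (f : X → ℝ) (hf : f p = 0) : Lip0 X p :=
  ⟨f, hf, by
    cases nonempty_fintype X
    refine ⟨∑ q : X × X, ‖(f q.1 - f q.2) / dist q.1 q.2‖₊,
      LipschitzWith.of_dist_le_mul fun x y => ?_⟩
    rcases eq_or_ne x y with rfl | hxy
    · simp
    · rw [← div_le_iff₀ (dist_pos.2 hxy)]
      have h := Finset.single_le_sum (f := fun q : X × X => ‖(f q.1 - f q.2) / dist q.1 q.2‖₊)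
        (fun _ _ => zero_le) (Finset.mem_univ (x, y))
      have h' : ‖(f x - f y) / dist x y‖ ≤ _ := NNReal.coe_le_coe.2 h
      rwa [norm_div, Real.norm_of_nonneg dist_nonneg, ← dist_eq_norm] at h'⟩

end Lip0

/-! ### Evaluation functionals -/

theorem delta_apply {X : Type*} [MetricSpace X] (p x : X) (f : Lip0 X p) : delta p x f = f x := rfl

theorem delta_base {X : Type*} [MetricSpace X] (p : X) : delta p p = 0 :=
  ContinuousLinearMap.ext fun f => Lip0.apply_base f

theorem lipschitzWith_delta {X : Type*} [MetricSpace X] (p : X) :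
    LipschitzWith 1 (delta p) := by
  refine LipschitzWith.of_dist_le_mul fun x y => ?_
  rw [dist_eq_norm, NNReal.coe_one, one_mul]
  refine ContinuousLinearMap.opNorm_le_bound _ dist_nonneg fun f => ?_
  have h := Lip0.abs_sub_le f x y
  rwa [mul_comm] at h

theorem delta_mem_freeSpace {X : Type*} [MetricSpace X] (p x : X) : delta p x ∈ freeSpace X p :=
  Submodule.le_topologicalClosure _ (Submodule.subset_span ⟨x, rfl⟩)

open Classical in
/-- The linear extension `Lip₀(X)* → E` of a map `f : X → E` on a finite metric space. -/
def linearize {X E : Type*} [MetricSpace X] [Fintype X] [NormedAddCommGroup E] [NormedSpace ℝ E]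
    (p : X) (f : X → E) : StrongDual ℝ (Lip0 X p) →ₗ[ℝ] E where
  -- The test function is the indicator of `x`, replaced by `0` when `x = p` so that it lies in
  -- `Lip₀`.
  toFun φ := ∑ x, φ (Lip0.ofFun (fun y => if y = x ∧ y ≠ p then 1 else 0) (by simp)) • f x
  map_add' φ ψ := by simp [add_smul, Finset.sum_add_distrib]
  map_smul' c φ := by simp [mul_smul, Finset.smul_sum]

section linearize

variable {X E : Type*} [MetricSpace X] [Fintype X] [NormedAddCommGroup E] [NormedSpace ℝ E]

theorem linearize_delta (p : X) (f : X → E) (hf : f p = 0) (x : X) :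
    linearize p f (delta p x) = f x := by
  classical
  have h : linearize p f (delta p x) =
      ∑ y, (if x = y ∧ x ≠ p then (1 : ℝ) else 0) • f y := rfl
  rw [h]
  rcases eq_or_ne x p with rfl | hx
  · simp [hf]
  · simp [hx]

/-- The modified indicators span `Lip₀(X)`, with the values of `g` as coefficients. Thus `linearize
p f` is dual to `ψ ↦ ψ ∘ f`. -/
theorem apply_linearize (p : X) (f : X → E) (ψ : StrongDual ℝ E)
    (φ : StrongDual ℝ (Lip0 X p)) (g : Lip0 X p) (hg : ∀ x, g x = ψ (f x)) :
    ψ (linearize p f φ) = φ g := by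
  classical
  have h : g = ∑ x, g x •
      (Lip0.ofFun (fun y => if y = x ∧ y ≠ p then 1 else 0) (by simp) : Lip0 X p) := by
    refine Lip0.ext fun y => ?_
    rw [Lip0.sum_apply]
    have h' : ∑ x, (if y = x ∧ y ≠ p then g x else 0) = g y := by
      rcases eq_or_ne y p with rfl | hy
      · simp [Lip0.apply_base]
      · simp [hy]
    rw [← h']
    refine Finset.sum_congr rfl fun x _ => ?_
    change _ = g x * (if y = x ∧ y ≠ p then 1 else 0)
    simp
  conv_rhs => rw [h]
  simp only [linearize, LinearMap.coe_mk, AddHom.coe_mk, map_sum, map_smul, hg, smul_eq_mul]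
  exact Finset.sum_congr rfl fun x _ => mul_comm _ _

/-- By Hahn–Banach it suffices to test against functionals `ψ`, and `ψ ∘ f` has norm at most `‖ψ‖ *
L` in `Lip₀(X)`. -/
theorem norm_linearize_le (p : X) {f : X → E} {L : ℝ≥0} (hf : f p = 0) (hL : LipschitzWith L f)
    (φ : StrongDual ℝ (Lip0 X p)) : ‖linearize p f φ‖ ≤ L * ‖φ‖ := by
  refine NormedSpace.norm_le_dual_bound ℝ _ (by positivity) fun ψ => ?_
  let g : Lip0 X p := Lip0.ofFun (fun x => ψ (f x)) (by simp [hf])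
  have hg : ‖g‖ ≤ ‖ψ‖ * L := by
    refine Lip0.norm_le _ (by positivity) fun x y => ?_
    change |ψ (f x) - ψ (f y)| ≤ _
    rw [← map_sub, ← Real.norm_eq_abs, mul_assoc]
    refine (ψ.le_opNorm _).trans ?_
    gcongr
    rw [← dist_eq_norm]
    exact hL.dist_le_mul x y
  rw [apply_linearize p f ψ φ g fun _ => rfl]
  calc ‖φ g‖ ≤ ‖φ‖ * ‖g‖ := φ.le_opNorm g
    _ ≤ ‖φ‖ * (‖ψ‖ * L) := by gcongr
    _ = _ := by ring

end linearize

/-- Over a finite metric space the Lipschitz-free space is the whole dual of `Lip₀`. -/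
theorem freeSpace_eq_top (X : Type*) [MetricSpace X] [Finite X] (p : X) : freeSpace X p = ⊤ := by
  cases nonempty_fintype X
  refine eq_top_iff.2 fun φ _ => ?_
  -- Linearizing `δ` itself gives the identity, which exhibits `φ` as a finite combination of the
  -- `δ(x)`.
  have h : linearize p (delta p) φ = φ := by
    ext g
    exact apply_linearize p (delta p) (ContinuousLinearMap.apply ℝ ℝ g) φ g fun _ => rfl
  rw [← h]
  exact Submodule.sum_mem _ fun x _ => Submodule.smul_mem _ _ (delta_mem_freeSpace p x)

/-! ### The canonical embedding of Lipschitz-free spaces -/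

/-- Restriction is non-expansive, which gives one inequality; McShane extension lifts each `f`
without increasing its norm, which gives the other. -/
theorem norm_dualMap {X Y : Type*} [MetricSpace X] [MetricSpace Y] (p : X) (ι : X → Y)
    (hι : Isometry ι) (φ : StrongDual ℝ (Lip0 X p)) : ‖dualMap p ι hι φ‖ = ‖φ‖ := by
  refine le_antisymm ?_ ?_
  · refine ContinuousLinearMap.opNorm_le_bound _ (norm_nonneg φ) fun f => ?_
    refine (φ.le_opNorm (Lip0.restrict p ι hι f)).trans ?_
    gcongr
    refine ((Lip0.restrict p ι hι).le_opNorm f).trans ?_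
    refine mul_le_of_le_one_left (norm_nonneg f) ?_
    exact LinearMap.mkContinuous_norm_le _ zero_le_one _
  · refine ContinuousLinearMap.opNorm_le_bound _ (norm_nonneg _) fun f => ?_
    obtain ⟨g, hg, hgf⟩ := exists_lipschitz_extension hι f.lipschitzWith
    let g' : Lip0 Y (ι p) := ⟨g, by rw [hgf, Lip0.apply_base], _, hg⟩
    have hg' : ‖g'‖ ≤ ‖f‖ := Lip0.norm_le _ (norm_nonneg f) fun x y => hg.dist_le_mul x y
    have hr : Lip0.restrict p ι hι g' = f := Lip0.ext hgf
    calc ‖φ f‖ = ‖dualMap p ι hι φ g'‖ := by rw [← hr]; rfl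
      _ ≤ ‖dualMap p ι hι φ‖ * ‖g'‖ := ContinuousLinearMap.le_opNorm _ _
      _ ≤ _ := by gcongr

/-- Projections onto the range of an isometric linear map correspond to its left inverses. -/
theorem projConst_range {G F : Type*} [NormedAddCommGroup G] [NormedSpace ℝ G]
    [NormedAddCommGroup F] [NormedSpace ℝ F] (T : G →L[ℝ] F) (hT : ∀ x, ‖T x‖ = ‖x‖) :
    projConst (LinearMap.range T.toLinearMap) =
      ⨅ (S : F →L[ℝ] G) (_ : ∀ x, S (T x) = x), ‖S‖ₑ := by
  refine le_antisymm (le_iInf₂ fun S hS => ?_) (le_iInf₂ fun P hP => ?_)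
  · let P : F →L[ℝ] LinearMap.range T.toLinearMap := (T.comp S).codRestrict _ fun y => ⟨S y, rfl⟩
    have hP : ∀ x : LinearMap.range T.toLinearMap, P x = x := by
      rintro ⟨_, x, rfl⟩
      exact Subtype.ext (congrArg T (hS x))
    refine (iInf₂_le P hP).trans (enorm_le_iff_norm_le.2 ?_)
    refine ContinuousLinearMap.opNorm_le_bound _ (norm_nonneg S) fun y => ?_
    exact (hT (S y)).trans_le (S.le_opNorm y)
  · let e := (⟨T.toLinearMap, hT⟩ : G →ₗᵢ[ℝ] F).equivRange
    let S : F →L[ℝ] G := (e.symm.toContinuousLinearEquiv : _ →L[ℝ] G).comp P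
    have hS : ∀ x, S (T x) = x := fun x => by
      have h : P (T x) = e x := hP ⟨T x, x, rfl⟩
      change e.symm (P (T x)) = x
      rw [h, e.symm_apply_apply]
    refine (iInf₂_le S hS).trans (enorm_le_iff_norm_le.2 ?_)
    refine ContinuousLinearMap.opNorm_le_bound _ (norm_nonneg P) fun y => ?_
    exact (e.symm.norm_map (P y)).trans_le (P.le_opNorm y)

/-! ### The optimal Lipschitz constant of an extension of `δ` -/

/-- The infimum of those `K` for which `δ : X → 𝓕(X)` extends along `ι : X → Y` to a `K`-Lipschitz
map on `Y`. The target is the full dual of `Lip₀(X)`, which equals `𝓕(X)` for finite `X`. -/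
def deltaExtConst {X Y : Type*} [MetricSpace X] [MetricSpace Y] (p : X) (ι : X → Y) : ℝ≥0∞ :=
  ⨅ (K : ℝ≥0) (_ : ∃ r : Y → StrongDual ℝ (Lip0 X p), LipschitzWith K r ∧
    ∀ x, r (ι x) = delta p x), (K : ℝ≥0∞)

theorem deltaExtConst_le {X Y : Type*} [MetricSpace X] [MetricSpace Y] {p : X} {ι : X → Y}
    {K : ℝ≥0} {r : Y → StrongDual ℝ (Lip0 X p)} (hr : LipschitzWith K r)
    (hrι : ∀ x, r (ι x) = delta p x) : deltaExtConst p ι ≤ K :=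
  iInf₂_le K ⟨r, hr, hrι⟩

/-- A non-expansive map `Y → Z` over `X` transports extensions of `δ` from `Z` to `Y`. -/
theorem deltaExtConst_mono {X Y Z : Type*} [MetricSpace X] [MetricSpace Y] [MetricSpace Z] (p : X)
    {ι : X → Y} {κ : X → Z} {h : Y → Z} (hh : LipschitzWith 1 h) (hc : ∀ x, h (ι x) = κ x) :
    deltaExtConst p ι ≤ deltaExtConst p κ := by
  refine le_iInf₂ fun K ⟨r, hr, hrκ⟩ => ?_
  refine deltaExtConst_le (r := r ∘ h) ?_ fun x => by simp [hc, hrκ]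
  simpa using hr.comp hh

/-- From `r`, precomposition with `pull r` gives a left inverse; finiteness of `X` ensures that it
lands in `𝓕(X)`. From a left inverse `S`, take `y ↦ S (δ y)`. -/
theorem freeProjConst_eq {X Y : Type*} [MetricSpace X] [Finite X] [MetricSpace Y] (p : X)
    (ι : X → Y) (hι : Isometry ι) : freeProjConst p ι hι = deltaExtConst p ι := by
  have key := projConst_range (G := freeSpace X p) (F := freeSpace Y (ι p)) (freeMap p ι hι)
    (by
      intro φ
      change ‖dualMap p ι hι φ.1‖ = ‖φ.1‖
      rw [norm_dualMap])
  refine Eq.trans key ?_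
  refine le_antisymm (le_iInf₂ fun K ⟨r, hr, hrι⟩ => ?_) (le_iInf₂ fun S hS => ?_)
  · have hq : r (ι p) = 0 := by rw [hrι, delta_base]
    let S : freeSpace Y (ι p) →L[ℝ] freeSpace X p :=
      (((Lip0.pull r hr hq).precomp ℝ).comp (freeSpace Y (ι p)).subtypeL).codRestrict _
        fun _ => by rw [freeSpace_eq_top]; trivial
    have hS : ∀ φ, S (freeMap p ι hι φ) = φ := by
      intro φ
      refine Subtype.ext (ContinuousLinearMap.ext fun f => ?_)
      have h : Lip0.restrict p ι hι (Lip0.pull r hr hq f) = f := by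
        refine Lip0.ext fun x => ?_
        change r (ι x) f = f x
        rw [hrι, delta_apply]
      change φ.1 (Lip0.restrict p ι hι (Lip0.pull r hr hq f)) = φ.1 f
      rw [h]
    have hSn : ∀ ψ, ‖S ψ‖ ≤ K * ‖ψ‖ := by
      intro ψ
      change ‖ψ.1.comp (Lip0.pull r hr hq)‖ ≤ K * ‖ψ.1‖
      refine (ContinuousLinearMap.opNorm_comp_le _ _).trans ?_
      rw [mul_comm]
      gcongr
      exact Lip0.norm_pull_le r hr hq
    refine (iInf₂_le S hS).trans ?_
    rw [← ofReal_norm]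
    exact ENNReal.ofReal_le_of_le_toReal (ContinuousLinearMap.opNorm_le_bound _ K.2 hSn)
  · have hlip : LipschitzWith ‖S‖₊ fun y =>
        (S ⟨delta (ι p) y, delta_mem_freeSpace _ y⟩ : StrongDual ℝ (Lip0 X p)) := by
      refine LipschitzWith.of_dist_le_mul fun y z => ?_
      refine (S.lipschitz.dist_le_mul _ _).trans ?_
      gcongr
      have h := (lipschitzWith_delta (ι p)).dist_le_mul y z
      rwa [NNReal.coe_one, one_mul] at h
    refine deltaExtConst_le hlip fun x => ?_
    exact congrArg Subtype.val (hS ⟨delta p x, delta_mem_freeSpace p x⟩)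

/-- A finite-dimensional real normed space has an isometric copy in every universe. -/
theorem exists_linearIsometryEquiv (G : Type u) [NormedAddCommGroup G] [NormedSpace ℝ G]
    [FiniteDimensional ℝ G] :
    ∃ (E : Type w) (_ : NormedAddCommGroup E) (_ : NormedSpace ℝ E), Nonempty (G ≃ₗᵢ[ℝ] E) := by
  let b := Module.finBasis ℝ G
  let e : ULift.{w} (Fin (Module.finrank ℝ G) → ℝ) ≃ G :=
    Equiv.ulift.trans b.equivFun.symm.toEquiv
  have : Small.{w} G := ⟨_, ⟨e.symm⟩⟩
  let l := Shrink.linearEquiv.{w} ℝ G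
  let i1 : NormedAddCommGroup (Shrink.{w} G) := NormedAddCommGroup.induced _ _ l l.injective
  let i2 : NormedSpace ℝ (Shrink.{w} G) := NormedSpace.induced ℝ _ _ l
  exact ⟨Shrink.{w} G, i1, i2, ⟨LinearIsometryEquiv.symm ⟨l, fun _ => rfl⟩⟩⟩

theorem traceConst_eq {X : Type u} {Y : Type v} [MetricSpace X] [Finite X] [MetricSpace Y] (p : X)
    (ι : X → Y) (hι : Isometry ι) :
    traceConst.{v, w} (Set.range ι) = deltaExtConst p ι := by
  refine le_antisymm (le_iInf₂ fun K ⟨r, hr, hrι⟩ => ?_) ?_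
  · refine iSup_le fun E => iSup_le fun _ => iSup_le fun _ => iSup_le fun _ => iSup_le fun f =>
      iSup_le fun hf => ?_
    cases nonempty_fintype X
    have hL := lipschitzWith_lipConst hf
    set L := lipConst f
    -- `linearize` reproduces only maps vanishing at `p`; the constant is added back after
    -- extending.
    let f' : X → E := fun x => f ⟨ι x, x, rfl⟩ - f ⟨ι p, p, rfl⟩
    have hf'p : f' p = 0 := sub_self _
    have hf' : LipschitzWith L f' := LipschitzWith.of_dist_le_mul fun x y => by
      rw [dist_sub_right, ← hι.dist_eq]
      exact hL.dist_le_mul _ _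
    refine iInf₂_le K ⟨fun y => linearize p f' (r y) + f ⟨ι p, p, rfl⟩, ?_, ?_⟩
    · refine LipschitzWith.of_dist_le_mul fun y z => ?_
      rw [dist_add_right, dist_eq_norm, ← map_sub]
      refine (norm_linearize_le p hf'p hf' _).trans ?_
      rw [NNReal.coe_mul, mul_comm (K : ℝ), mul_assoc, ← dist_eq_norm]
      gcongr
      exact hr.dist_le_mul y z
    · rintro ⟨_, x, rfl⟩
      simp only [hrι, linearize_delta p f' hf'p, f', sub_add_cancel]
  -- The extremal target is `Lip₀(X)*`, copied into the universe of the test spaces `E`; the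
  -- extremal map is `δ`.
  · obtain ⟨E, i1, i2, ⟨e⟩⟩ :=
      exists_linearIsometryEquiv.{_, w} (StrongDual ℝ (Lip0 X p))
    have i3 : CompleteSpace E :=
      e.toIsometryEquiv.completeSpace_iff.1 inferInstance
    let s : Set.range ι → X := fun y => Classical.choose y.2
    have hs : ∀ y, ι (s y) = y := fun y => Classical.choose_spec y.2
    let f : Set.range ι → E := fun y => e (delta p (s y))
    have hf : LipschitzWith 1 f := by
      refine LipschitzWith.of_dist_le_mul fun y z => ?_
      rw [e.dist_map]
      refine ((lipschitzWith_delta p).dist_le_mul _ _).trans (le_of_eq ?_)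
      rw [← hι.dist_eq, hs, hs]
      rfl
    refine le_trans ?_ (le_iSup_of_le E <| le_iSup_of_le i1 <| le_iSup_of_le i2 <|
      le_iSup_of_le i3 <| le_iSup_of_le f <| le_iSup_of_le ⟨1, hf⟩ le_rfl)
    refine le_iInf₂ fun K ⟨g, hg, hgf⟩ => ?_
    refine deltaExtConst_le (r := fun y => e.symm (g y)) ?_ fun x => ?_
    · refine LipschitzWith.of_dist_le_mul fun y z => ?_
      rw [e.symm.dist_map]
      refine (hg.dist_le_mul y z).trans ?_
      have hKL : K * lipConst f ≤ K := mul_le_of_le_one_right zero_le (lipConst_le hf)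
      gcongr
    · have hx : s ⟨ι x, x, rfl⟩ = x := hι.injective (hs _)
      have h := hgf ⟨ι x, x, rfl⟩
      simp only [f, hx] at h
      rw [h, e.symm_apply_apply]

theorem absExt_eq (X : Type u) [MetricSpace X] [Finite X] (p : X) :
    absExt.{u, v, w} X = ⨆ (Y : Type v) (_ : MetricSpace Y) (ι : X → Y) (_ : Isometry ι),
      deltaExtConst p ι := by
  simp only [absExt]
  refine iSup_congr fun Y => iSup_congr fun _ => iSup_congr fun ι => iSup_congr fun hι => ?_
  exact traceConst_eq p ι hι

/-! ### Reduction to finite metric spaces -/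

open Filter in
/-- Compactness: extensions of `δ` to all finite subspaces of `Y` with a common Lipschitz constant
yield an extension to `Y`. -/
theorem deltaExtConst_le_of_finite {X : Type u} {Y : Type v} [MetricSpace X] [Finite X]
    [MetricSpace Y] (p : X) (ι : X → Y) {K : ℝ≥0}
    (h : ∀ (S : Set Y) (_ : S.Finite) (hS : ∀ x, ι x ∈ S),
      deltaExtConst p (fun x => (⟨ι x, hS x⟩ : S)) < K) :
    deltaExtConst p ι ≤ K := by
  classical
  have hr : ∀ F : Finset Y, ∃ r : Y → StrongDual ℝ (Lip0 X p),
      (∀ x ∈ F, ∀ y ∈ F, dist (r x) (r y) ≤ K * dist x y) ∧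
      (∀ x ∈ F, ‖r x‖ ≤ K * dist x (ι p)) ∧ ∀ x, r (ι x) = delta p x := by
    intro F
    have hlt := h (F ∪ Set.range ι) (F.finite_toSet.union (Set.finite_range ι))
      fun x => Or.inr ⟨x, rfl⟩
    simp only [deltaExtConst, iInf_lt_iff] at hlt
    -- The strict bound supplies an actual extension, without knowing that the infimum is attained.
    obtain ⟨K', ⟨r, hr, hrι⟩, hK'⟩ := hlt
    replace hr : LipschitzWith K r := hr.weaken (by exact_mod_cast hK'.le)
    refine ⟨fun y => if hy : y ∈ (F ∪ Set.range ι : Set Y) then r ⟨y, hy⟩ else 0, ?_, ?_, ?_⟩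
    · intro x hx y hy
      have hx' : x ∈ (F ∪ Set.range ι : Set Y) := Or.inl hx
      have hy' : y ∈ (F ∪ Set.range ι : Set Y) := Or.inl hy
      simp only [dif_pos hx', dif_pos hy']
      exact hr.dist_le_mul _ _
    · intro x hx
      have hx' : x ∈ (F ∪ Set.range ι : Set Y) := Or.inl hx
      simp only [dif_pos hx']
      rw [← sub_zero (r _), ← delta_base p, ← hrι p, ← dist_eq_norm]
      exact hr.dist_le_mul _ _
    · intro x
      have hx' : ι x ∈ (F ∪ Set.range ι : Set Y) := Or.inr ⟨x, rfl⟩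
      simp only [dif_pos hx', hrι]
  choose r hr1 hr2 hr3 using hr
  -- Along `U` each point eventually lies in `F`; the values there stay in a fixed ball since `r (ι
  -- p) = 0`, so they converge.
  let U : Ultrafilter (Finset Y) := Ultrafilter.of atTop
  have hU : (U : Filter (Finset Y)) ≤ atTop := Ultrafilter.of_le _
  have hmem : ∀ y : Y, ∀ᶠ F in (U : Filter (Finset Y)), y ∈ F := fun y =>
    hU ((eventually_ge_atTop {y}).mono fun F hF => hF (Finset.mem_singleton_self y))
  have hlim : ∀ y, ∃ a, Tendsto (fun F => r F y) U (nhds a) := by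
    intro y
    have : ProperSpace (StrongDual ℝ (Lip0 X p)) := FiniteDimensional.proper ℝ _
    obtain ⟨a, -, ha⟩ := (isCompact_closedBall (0 : StrongDual ℝ (Lip0 X p))
      (K * dist y (ι p))).ultrafilter_le_nhds (U.map fun F => r F y) (by
        rw [le_principal_iff]
        exact (hmem y).mono fun F hF => by
          rw [mem_closedBall_zero_iff]
          exact hr2 F y hF)
    exact ⟨a, ha⟩
  choose R hR using hlim
  refine deltaExtConst_le (r := R) (LipschitzWith.of_dist_le_mul fun x y => ?_) fun x => ?_
  · refine le_of_tendsto ((hR x).dist (hR y)) ?_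
    filter_upwards [hmem x, hmem y] with F hx hy using hr1 F x hx y hy
  · refine tendsto_nhds_unique (hR (ι x)) ?_
    simp only [hr3]
    exact tendsto_const_nhds

theorem iSup_deltaExtConst_eq_iSup_finite (X : Type u) [MetricSpace X] [Finite X] (p : X) :
    (⨆ (Y : Type v) (_ : MetricSpace Y) (ι : X → Y) (_ : Isometry ι), deltaExtConst p ι) =
      ⨆ (Y : Type v) (_ : MetricSpace Y) (_ : Finite Y) (ι : X → Y) (_ : Isometry ι),
        deltaExtConst p ι := by
  refine le_antisymm ?_ ?_
  · refine iSup_le fun Y => iSup_le fun _ => iSup_le fun ι => iSup_le fun hι => ?_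
    refine le_of_forall_gt fun a ha => ?_
    obtain ⟨K, hK, hKa⟩ := ENNReal.lt_iff_exists_nnreal_btwn.1 ha
    refine lt_of_le_of_lt ?_ hKa
    refine deltaExtConst_le_of_finite p ι fun S hS hιS => lt_of_le_of_lt ?_ hK
    have hι' : Isometry fun x => (⟨ι x, hιS x⟩ : S) := fun x y => hι x y
    exact le_iSup_of_le S <| le_iSup_of_le inferInstance <| le_iSup_of_le hS.to_subtype <|
      le_iSup_of_le _ <| le_iSup_of_le hι' le_rfl
  · refine iSup_le fun Y => iSup_le fun i => iSup_le fun _ => iSup_le fun ι => iSup_le fun hι => ?_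
    exact le_iSup_of_le Y <| le_iSup_of_le i <| le_iSup_of_le ι <| le_iSup_of_le hι le_rfl

/-! ### Embeddings into `c₀` -/

/-- An isometric embedding of a finite metric space into `c₀` extends to a non-expansive map on
every larger metric space. -/
theorem exists_lipschitz_extension_c0 {X Y : Type*} [MetricSpace X] [Finite X]
    [MetricSpace Y] {j : X → Y} (hj : Isometry j) (ι : X → C₀(ℕ, ℝ)) (hι : Isometry ι) :
    ∃ h : Y → C₀(ℕ, ℝ), LipschitzWith 1 h ∧ ∀ x, h (j x) = ι x := by
  cases nonempty_fintype X
  -- A null sequence dominating all points of the finite set `ι(X)`. Truncating the McShane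
  -- extensions at `±B k` keeps them non-expansive and correct on `X`, and forces their values into
  -- `c₀`.
  let B : ℕ → ℝ := fun k => ∑ x, |ι x k|
  have hB : ∀ k, 0 ≤ B k := fun k => Finset.sum_nonneg fun _ _ => abs_nonneg _
  have hιB : ∀ x k, |ι x k| ≤ B k := fun x k =>
    Finset.single_le_sum (f := fun x => |ι x k|) (fun _ _ => abs_nonneg _) (Finset.mem_univ x)
  have hcoord : ∀ k, LipschitzWith 1 fun x => ι x k := fun k =>
    LipschitzWith.of_dist_le_mul fun x y => by
      rw [NNReal.coe_one, one_mul, ← hι.dist_eq, ← ZeroAtInftyContinuousMap.dist_toBCF_eq_dist]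
      exact BoundedContinuousFunction.dist_coe_le_dist (f := (ι x).toBCF) (g := (ι y).toBCF) k
  choose g hg hgι using fun k => exists_lipschitz_extension hj (hcoord k)
  let c : ℕ → Y → ℝ := fun k y => max (-B k) (min (B k) (g k y))
  have hc : ∀ k, LipschitzWith 1 (c k) := fun k => ((hg k).const_min _).const_max _
  have hcB : ∀ k y, |c k y| ≤ B k := fun k y =>
    abs_le.2 ⟨le_max_left _ _, max_le (by linarith [hB k]) (min_le_left _ _)⟩
  have hBlim : Filter.Tendsto B (Filter.cocompact ℕ) (nhds 0) := by
    have h := tendsto_finsetSum (Finset.univ : Finset X) fun x _ => (ι x).zero_at_infty'.abs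
    simpa using h
  refine ⟨fun y => ⟨⟨fun k => c k y, continuous_of_discreteTopology⟩,
    squeeze_zero_norm (fun k => hcB k y) hBlim⟩, LipschitzWith.of_dist_le_mul fun y z => ?_,
    fun x => ZeroAtInftyContinuousMap.ext fun k => ?_⟩
  · rw [← ZeroAtInftyContinuousMap.dist_toBCF_eq_dist,
      BoundedContinuousFunction.dist_le (by positivity)]
    exact fun k => (hc k).dist_le_mul y z
  · change max (-B k) (min (B k) (g k (j x))) = ι x k
    have h := abs_le.1 (hιB x k)
    rw [hgι, min_eq_right h.2, max_eq_right h.1]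

theorem iSup_deltaExtConst_eq_c0 (X : Type u) [MetricSpace X] [Finite X] (p : X)
    (ι : X → C₀(ℕ, ℝ)) (hι : Isometry ι) :
    (⨆ (Y : Type v) (_ : MetricSpace Y) (j : X → Y) (_ : Isometry j), deltaExtConst p j) =
      deltaExtConst p ι := by
  refine le_antisymm ?_ ?_
  · refine iSup_le fun Y => iSup_le fun _ => iSup_le fun j => iSup_le fun hj => ?_
    obtain ⟨h, hh, hhj⟩ := exists_lipschitz_extension_c0 hj ι hι
    exact deltaExtConst_mono p hh hhj
  -- `c₀` itself, lifted to the right universe, is one of the competing spaces.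
  · have hup : Isometry fun x => ULift.up.{v} (ι x) := fun x y => hι x y
    refine le_trans (deltaExtConst_mono p (h := ULift.up.{v}) ?_ fun _ => rfl)
      (le_iSup_of_le (ULift.{v} C₀(ℕ, ℝ)) <| le_iSup_of_le inferInstance <|
        le_iSup_of_le (fun x => ULift.up (ι x)) <| le_iSup_of_le hup le_rfl)
    exact Isometry.lipschitz fun x y => rfl

end LipExt

end

theorem theorem1p4 (X : Type u) [MetricSpace X] [Finite X] (p : X) :
    (LipExt.absExt.{u, v, w} X =
      ⨆ (Y : Type v) (_ : MetricSpace Y) (_ : Finite Y) (ι : X → Y) (hι : Isometry ι),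
        LipExt.freeProjConst p ι hι) ∧
    (∀ (ι : X → C₀(ℕ, ℝ)) (hι : Isometry ι),
      LipExt.absExt.{u, v, w} X = LipExt.freeProjConst p ι hι) := by
  refine ⟨?_, fun ι hι => ?_⟩
  · rw [LipExt.absExt_eq X p, LipExt.iSup_deltaExtConst_eq_iSup_finite]
    simp only [LipExt.freeProjConst_eq]
  · rw [LipExt.absExt_eq X p, LipExt.iSup_deltaExtConst_eq_c0 X p ι hι, LipExt.freeProjConst_eq]
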